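/- **Setting.** Let $d\ge 0$, $n\ge 1$, $p\ge 1$ be integers, $z_1,\dots,z_n$ data points, $\ell(z,\beta)$ a real loss with each $\ell(z_i,\cdot):\mathbb R^d\to\mathbb R$ differentiable, and $\pi:\mathbb R^d\to\mathbb R$ a regularizer. For $\lambda\in[0,\infty)$ put $$m(\beta,\lambda)=\tfrac1n\sum_{j=1}^n\ell(z_j,\beta)+\lambda\pi(\beta),\qquad m_{-i}(\beta,\lambda)=\tfrac1n\sum_{j\ne i}\ell(z_j,\beta)+\lambda\pi(\beta),$$ and $m(\beta,\infty)=m_{-i}(\beta,\infty)=\pi(\beta)$. Norms are Euclidean norms and the induced operator norms of tensors, and $\mathrm{Lip}(f)=\sup_{x\ne y}\|f(x)-f(y)\|/\|x-y\|\in[0,\infty]$. A function $\varphi$ has $\nu$ gradient growth if its (convex-analysis) subdifferential $\partial\varphi$ is nonempty at every point and $\nu(\|x-y\|)\le\langle y-x,u-v\rangle$ for all $x,y$, $u\in\partial\varphi(y)$, $v\in\partial\varphi(x)$. Let $\Lambda\subseteq[0,\infty]$, and for each $\lambda\in\Lambda$ let $\hat\beta(\lambda)$ be a global minimizer of $m(\cdot,\lambda)$.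 Let $\hat\beta_{-i}(\lambda)$ denote a global minimizer of $m_{-i}(\cdot,\lambda)$, and let $\hat\beta^{(p)}_{-i}(\lambda)$ denote a global minimizer of $$\beta\mapsto\sum_{k=0}^p\frac1{k!}\nabla_\beta^k m_{-i}(\hat\beta(\lambda),\lambda)[\beta-\hat\beta(\lambda)]^{\otimes k}+\frac{\mathrm{Lip}(\nabla_\beta^p m_{-i}(\cdot,\lambda))}{(p+1)!}\|\beta-\hat\beta(\lambda)\|^{p+1}.$$ Set $\mathrm{CV}(\lambda)=\frac1n\sum_i\ell(z_i,\hat\beta_{-i}(\lambda))$ and $\mathrm{ACV}_p(\lambda)=\frac1n\sum_i\ell(z_i,\hat\beta^{(p)}_{-i}(\lambda))$. **Assumptions.** Let $c_\ell,c_\pi>0$, let $\lambda_\pi,C_{\ell,p+1},C_{\pi,p+1}\in[0,\infty)$, and put $c_{\lambda,\lambda}=c_\ell+\lambda c_\pi\mathbf 1[\lambda\ge\lambda_\pi]$ (so $c_{\infty,\infty}=\infty$). Suppose: 1. for all $\lambda\in\Lambda$ and $i$, $m_{-i}(\cdot,\lambda)$ has $\nu(r)=c_{\lambda,\lambda}r^2$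 gradient growth if $\lambda<\infty$, and $\nu(r)=c_\pi r^2$ gradient growth if $\lambda=\infty$; 2. for all $\lambda\in\Lambda$ and $i$, $m_{-i}(\cdot,\lambda)$ is $p$ times continuously differentiable, and $\mathrm{Lip}(\nabla^p_\beta m_{-i}(\cdot,\lambda))\le C_{\ell,p+1}+\lambda C_{\pi,p+1}$ if $\lambda<\infty$, $\mathrm{Lip}(\nabla^p_\beta m_{-i}(\cdot,\lambda))\le C_{\pi,p+1}$ if $\lambda=\infty$; 3. for each $(s,r)\in\{(0,p+1),(1,p+1),(1,2p)\}$, $$B_{s,r}=\sup_{\lambda\in\Lambda}\frac1n\sum_{i=1}^n\mathrm{Lip}(\nabla_\beta\ell(z_i,\cdot))^s\,\|\nabla_\beta\ell(z_i,\hat\beta(\lambda))\|^r<\infty$$ (with $0\cdot\infty=0$ and $\infty^0=1$). **Conclusion.** For all $\lambda\in\Lambda$ and $i$ the minimizers $\hat\beta_{-i}(\lambda)$ and $\hat\beta^{(p)}_{-i}(\lambda)$ exist; the constant $$\kappa_p=\sup_{0\le\lambda<\infty}\frac{C_{\ell,p+1}+\lambda C_{\pi,p+1}}{p!\,c_{\lambda,\lambda}}\quad\text{satisfies}\quad\kappa_p\le\max\Big(\frac{C_{\ell,p+1}+\lambda_\pi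 C_{\pi,p+1}}{p!\,c_\ell},\frac{C_{\pi,p+1}}{p!\,c_\pi}\Big);$$ and for every $\lambda\in\Lambda$ and every choice of these minimizers $$|\mathrm{ACV}_p(\lambda)-\mathrm{CV}(\lambda)|\le\frac{2\kappa_p}{n^p}\left(\frac{B_{0,p+1}}{c_{\lambda,\lambda}^p}+\frac{B_{1,p+1}}{n\,c_{\lambda,\lambda}^{p+1}}+\frac{\kappa_p\,B_{1,2p}}{n^p\,c_{\lambda,\lambda}^{2p}}\right),$$ where the right-hand side is $0$ if $\lambda=\infty$. -/

import Mathlib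

open scoped ENNReal NNReal InnerProductSpace

noncomputable section

namespace ApproxCV

/-- The parameter space: `ℝ^d` with its Euclidean norm. -/
abbrev Param (d : ℕ) : Type := EuclideanSpace ℝ (Fin d)

/-- The best Lipschitz constant `sup_{x ≠ y} ‖f x - f y‖ / ‖x - y‖`, as an extended nonnegative
real. For `f = ∇^p φ` the codomain carries the operator norm of tensors. -/
def lipConst {X Y : Type*} [PseudoEMetricSpace X] [PseudoEMetricSpace Y] (f : X → Y) : ℝ≥0∞ :=
  ⨆ (x : X) (y : X) (_ : x ≠ y), edist (f x) (f y) / edist x y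

/-- The subdifferential of convex analysis. -/
def subdifferential {d : ℕ} (φ : Param d → ℝ) (x : Param d) : Set (Param d) :=
  {u | ∀ y, φ x + ⟪u, y - x⟫_ℝ ≤ φ y}

/-- `φ` has `ν` gradient growth: it is subdifferentiable everywhere, and
`ν ‖x - y‖ ≤ ⟪y - x, u - v⟫` for all `u ∈ ∂φ(y)`, `v ∈ ∂φ(x)`. -/
def HasGradientGrowth {d : ℕ} (ν : ℝ → ℝ) (φ : Param d → ℝ) : Prop :=
  (∀ x, (subdifferential φ x).Nonempty) ∧
    ∀ x y, ∀ u ∈ subdifferential φ y, ∀ v ∈ subdifferential φ x,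
      ν ‖x - y‖ ≤ ⟪y - x, u - v⟫_ℝ

/-- `x` is a global minimizer of `φ`. -/
def IsArgmin {d : ℕ} (φ : Param d → ℝ) (x : Param d) : Prop :=
  ∀ y, φ x ≤ φ y

section Objectives

variable {𝒳 : Type*} {d n : ℕ}

/-- The full-data objective `(1/n) ∑_j ℓ(z_j, β) + lam π(β)`; at `lam = ∞` it is `π`. -/
def fullObjective (loss : 𝒳 → Param d → ℝ) (reg : Param d → ℝ) (z : Fin n → 𝒳)
    (lam : ℝ≥0∞) (β : Param d) : ℝ :=
  if lam = ∞ then reg β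
  else (1 / (n : ℝ)) * ∑ j, loss (z j) β + lam.toReal * reg β

/-- The leave-one-out objective `(1/n) ∑_{j ≠ i} ℓ(z_j, β) + lam π(β)`; at `lam = ∞` it
is `π`. -/
def looObjective (loss : 𝒳 → Param d → ℝ) (reg : Param d → ℝ) (z : Fin n → 𝒳)
    (i : Fin n) (lam : ℝ≥0∞) (β : Param d) : ℝ :=
  if lam = ∞ then reg β
  else (1 / (n : ℝ)) * ∑ j ∈ Finset.univ.erase i, loss (z j) β + lam.toReal * reg β

/-- The average loss `(1/n) ∑_i ℓ(z_i, b_i)`, where `b_i` is the estimator used for fold `i`.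
It is `CV` for the leave-one-out estimators and `ACV_p` for their approximations. -/
def foldError (loss : 𝒳 → Param d → ℝ) (z : Fin n → 𝒳) (b : Fin n → Param d) : ℝ :=
  (1 / (n : ℝ)) * ∑ i, loss (z i) (b i)

end Objectives

/-- The `p`-th order Taylor polynomial of `f` about `w`, evaluated at `β`. -/
def taylorPoly {d : ℕ} (p : ℕ) (f : Param d → ℝ) (w β : Param d) : ℝ :=
  ∑ k ∈ Finset.range (p + 1),
    (1 / (k.factorial : ℝ)) * iteratedFDeriv ℝ k f w (fun _ => β - w)

/-- The regularized Taylor approximation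
`f̂_p(β; w) + Lip(∇^p f) / (p+1)! * ‖β - w‖^(p+1)`. -/
def regTaylor {d : ℕ} (p : ℕ) (f : Param d → ℝ) (w β : Param d) : ℝ :=
  taylorPoly p f w β +
    (lipConst (iteratedFDeriv ℝ p f)).toReal / ((p + 1).factorial : ℝ) * ‖β - w‖ ^ (p + 1)

/-- The curvature constant `c_{lam,lam} = c_ℓ + lam c_π 1[lam ≥ lam_π]`
(infinite at `lam = ∞` when `c_π > 0`). -/
def curvature (cl cr lamr : ℝ≥0) (lam : ℝ≥0∞) : ℝ≥0∞ :=
  (cl : ℝ≥0∞) + lam * (if (lamr : ℝ≥0∞) ≤ lam then (cr : ℝ≥0∞) else 0)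

/-- Curvature of objective: each leave-one-out objective has gradient growth
`c_{lam,lam} r^2`. At `lam = ∞`, where the objective is `π = lim (1/lam) m(·, lam)`, the constant
is `c_π = lim (1/lam) c_{lam,lam}`. -/
def CurvedObjective {𝒳 : Type*} {d n : ℕ} (loss : 𝒳 → Param d → ℝ) (reg : Param d → ℝ)
    (z : Fin n → 𝒳) (Lam : Set ℝ≥0∞) (cl cr lamr : ℝ≥0) : Prop :=
  ∀ lam ∈ Lam, ∀ i : Fin n,
    HasGradientGrowth
      (fun r => (if lam = ∞ then (cr : ℝ) else (curvature cl cr lamr lam).toReal) * r ^ 2)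
      (looObjective loss reg z i lam)

/-- Lipschitz `p`-th derivative: each leave-one-out objective is `p` times continuously
differentiable with `Lip(∇^p m) ≤ C_ℓ + lam C_π`. At `lam = ∞`, where the objective is `π`, the
bound is `C_π = lim (1/lam) (C_ℓ + lam C_π)`. -/
def LipschitzDerivObjective {𝒳 : Type*} {d n : ℕ} (p : ℕ) (loss : 𝒳 → Param d → ℝ)
    (reg : Param d → ℝ) (z : Fin n → 𝒳) (Lam : Set ℝ≥0∞) (Cl Cr : ℝ≥0) : Prop :=
  ∀ lam ∈ Lam, ∀ i : Fin n,
    ContDiff ℝ p (looObjective loss reg z i lam) ∧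
      lipConst (iteratedFDeriv ℝ p (looObjective loss reg z i lam)) ≤
        if lam = ∞ then (Cr : ℝ≥0∞) else (Cl : ℝ≥0∞) + lam * Cr

/-- The moment
`B_{s,r} = sup_{lam ∈ Lam} (1/n) ∑_i Lip(∇ℓ(z_i, ·))^s ‖∇ℓ(z_i, est(lam))‖^r`. -/
def lossMoment {𝒳 : Type*} {d n : ℕ} (loss : 𝒳 → Param d → ℝ) (z : Fin n → 𝒳)
    (Lam : Set ℝ≥0∞) (est : ℝ≥0∞ → Param d) (s r : ℕ) : ℝ≥0∞ :=
  ⨆ lam ∈ Lam, (1 / (n : ℝ≥0∞)) *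
    ∑ i, lipConst (gradient (loss (z i))) ^ s * ‖gradient (loss (z i)) (est lam)‖ₑ ^ r

/-- `κ_p = sup_{0 ≤ lam < ∞} (C_ℓ + lam C_π) / (p! c_{lam,lam})`. -/
def kappa (p : ℕ) (cl cr lamr Cl Cr : ℝ≥0) : ℝ≥0∞ :=
  ⨆ lam : ℝ≥0, ((Cl : ℝ≥0∞) + lam * Cr) / ((p.factorial : ℝ≥0∞) * curvature cl cr lamr lam)

end ApproxCV

end

/-! Fix a fold and finite `λ`. Let `f` be the leave-one-out objective, `c` its curvature, `w` the
full-data estimator, `y` the minimizer of `f`, `x` that of its regularized Taylor approximation, and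
`γ = ‖∇ℓ(z_i, w)‖`. Optimality of `w` gives `‖f'(w)‖ = γ/n`. Gradient growth is strong monotonicity
of `f'`, so any point where `f` does not increase radially away from `w` lies within `ρ = γ/(nc)` of
`w`; this covers `y`, and also `x`, because the regularizer exactly absorbs the Taylor remainder of
`f'` (`IsArgmin.fderiv_radial_nonpos`). Stationarity of `x` bounds `‖f'(x)‖` by twice that
remainder, so monotonicity between `x` and `y` gives `‖x - y‖ ≤ 2κ_p ρ^p`
(`IsArgmin.mul_norm_sub_regTaylor_le`). The loss has slope at most `γ + Lip(∇ℓ)ρ` on the ball;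
averaging over folds gives the first two terms of the bound. -/

noncomputable section

namespace ApproxCV

/-! ### Taylor's theorem for vector-valued maps. -/

section Taylor

variable {E G : Type} [NormedAddCommGroup E] [NormedSpace ℝ E] [NormedAddCommGroup G]
  [NormedSpace ℝ G]

/-- Evaluating an iterated derivative at a tuple whose entries all equal `r` except one, the
position of the exceptional entry does not matter. -/
theorem iteratedFDeriv_update_const (k : ℕ) :
    ∀ {G : Type} [NormedAddCommGroup G] [NormedSpace ℝ G] {F : E → G},
      ContDiff ℝ (k + 1 : ℕ) F → ∀ (w r v : E) (i : Fin (k + 1)),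
      iteratedFDeriv ℝ (k + 1) F w (Function.update (fun _ => r) i v) =
        iteratedFDeriv ℝ k (fderiv ℝ F) w (fun _ => r) v := by
  induction k with
  | zero =>
    intro G _ _ F _ w r v i
    rw [iteratedFDeriv_succ_apply_right, Fin.fin_one_eq_zero i]
    simp [Fin.last]
  | succ k ih =>
    intro G _ _ F hF w r v i
    rw [iteratedFDeriv_succ_apply_right]
    have hF' : ContDiff ℝ (k + 1 : ℕ) (fderiv ℝ F) :=
      hF.fderiv_right (by norm_cast)
    have hF'' : ContDiff ℝ k (fderiv ℝ (fderiv ℝ F)) :=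
      hF'.fderiv_right (by norm_cast)
    induction i using Fin.lastCases with
    | last =>
      have h1 : Fin.init (Function.update (fun _ : Fin (k + 2) => r) (Fin.last (k + 1)) v) =
          fun _ => r := by
        ext j
        simp [Fin.init]
      rw [h1, Function.update_self]
    | cast i =>
      have h1 : Fin.init (Function.update (fun _ : Fin (k + 2) => r) i.castSucc v) =
          Function.update (fun _ => r) i v := by
        ext j
        by_cases h : j = i
        · subst h; simp [Fin.init]
        · simp [Fin.init, h]
      rw [h1, ih hF', Function.update_of_ne (Fin.castSucc_lt_last i).ne',
        iteratedFDeriv_succ_apply_right]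
      -- Evaluation at `a`, `b` is linear, so it commutes with the iterated derivative; symmetry of
      -- the second derivative then swaps `v` with the last `r`.
      have happ : ∀ a b : E, iteratedFDeriv ℝ k (fderiv ℝ (fderiv ℝ F)) w (fun _ => r) a b =
          iteratedFDeriv ℝ k (fun y => fderiv ℝ (fderiv ℝ F) y a b) w (fun _ => r) := by
        intro a b
        have := ContinuousLinearMap.iteratedFDeriv_comp_left
          ((ContinuousLinearMap.apply ℝ G b).comp (ContinuousLinearMap.apply ℝ (E →L[ℝ] G) a))
          (hF''.contDiffAt (x := w)) (i := k) le_rfl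
        have h2 := congrArg (fun M => M (fun _ => r)) this
        exact h2.symm
      have hsymm : (fun y => fderiv ℝ (fderiv ℝ F) y v r) =
          fun y => fderiv ℝ (fderiv ℝ F) y r v := by
        ext y
        refine (ContDiffAt.isSymmSndFDerivAt (hF.contDiffAt (x := y)) ?_).eq v r
        rw [minSmoothness_of_isRCLikeNormedField]
        exact_mod_cast (by omega : 2 ≤ k + 1 + 1)
      have h3 : Fin.init (fun _ : Fin (k + 1) => r) = fun _ => r := rfl
      rw [h3]
      exact (happ v r).trans (by rw [hsymm]; exact (happ r v).symm)

/-- The product rule gives one term per slot, and by symmetry all `k + 1` terms agree. -/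
theorem hasFDerivAt_iteratedFDeriv_diag {F : E → G} {k : ℕ} (hF : ContDiff ℝ (k + 1 : ℕ) F)
    (w x : E) :
    HasFDerivAt (fun y => iteratedFDeriv ℝ (k + 1) F w (fun _ => y - w))
      (((k : ℝ) + 1) • iteratedFDeriv ℝ k (fderiv ℝ F) w (fun _ => x - w)) x := by
  have h := HasFDerivAt.multilinear_comp (iteratedFDeriv ℝ (k + 1) F w)
    (g := fun _ y => y - w) (g' := fun _ => ContinuousLinearMap.id ℝ E) (x := x)
    (fun _ => (hasFDerivAt_id x).sub_const w)
  convert h using 1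
  ext v
  simp only [sum_apply, ContinuousLinearMap.comp_apply]
  have : ∀ i : Fin (k + 1), ((iteratedFDeriv ℝ (k + 1) F w).toContinuousLinearMap
      (fun _ => x - w) i) v = iteratedFDeriv ℝ k (fderiv ℝ F) w (fun _ => x - w) v := fun i =>
    iteratedFDeriv_update_const k hF w (x - w) v i
  simp [this, add_smul, ← Nat.cast_smul_eq_nsmul ℝ]

/-- The Taylor polynomial of order `p` of a vector-valued function. -/
def vectorTaylor (p : ℕ) (F : E → G) (w x : E) : G :=
  ∑ k ∈ Finset.range (p + 1),
    (1 / (k.factorial : ℝ)) • iteratedFDeriv ℝ k F w (fun _ => x - w)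

/-- The constant term drops out and `(k + 1) / (k + 1)! = 1 / k!`. This drives the induction in
Taylor's theorem and computes the gradient of `regTaylor`. -/
theorem hasFDerivAt_vectorTaylor {F : E → G} {p : ℕ} (hF : ContDiff ℝ (p + 1 : ℕ) F) (w x : E) :
    HasFDerivAt (vectorTaylor (p + 1) F w) (vectorTaylor p (fderiv ℝ F) w x) x := by
  have h : HasFDerivAt (fun y => (∑ k ∈ Finset.range (p + 1), (1 / ((k + 1).factorial : ℝ)) •
      iteratedFDeriv ℝ (k + 1) F w (fun _ => y - w)) + F w)
      (vectorTaylor p (fderiv ℝ F) w x) x := by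
    refine HasFDerivAt.add_const _ ?_
    refine (HasFDerivAt.fun_sum (u := Finset.range (p + 1))
      (A' := fun k => (1 / ((k + 1).factorial : ℝ)) • (((k : ℝ) + 1) •
        iteratedFDeriv ℝ k (fderiv ℝ F) w (fun _ => x - w))) fun k hk => ?_).congr_fderiv ?_
    · refine (hasFDerivAt_iteratedFDeriv_diag (hF.of_le ?_) w x).const_smul _
      have := Finset.mem_range.1 hk
      exact_mod_cast (by omega : k + 1 ≤ p + 1)
    · refine Finset.sum_congr rfl fun k _ => ?_
      rw [smul_smul]
      congr 1
      rw [Nat.factorial_succ]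
      have : (k.factorial : ℝ) ≠ 0 := by positivity
      push_cast
      field_simp
  refine h.congr_of_eventuallyEq (Filter.Eventually.of_forall fun y => ?_)
  simp [vectorTaylor, Finset.sum_range_succ' _ (p + 1)]

theorem vectorTaylor_self (p : ℕ) (F : E → G) (w : E) : vectorTaylor p F w w = F w := by
  rw [vectorTaylor, Finset.sum_range_succ']
  have : ∀ k, iteratedFDeriv ℝ (k + 1) F w (fun _ => w - w) = 0 := fun k => by
    rw [sub_self]
    exact (iteratedFDeriv ℝ (k + 1) F w).map_coord_zero 0 rfl
  simp only [this, smul_zero, Finset.sum_const_zero]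
  simp

theorem norm_iteratedFDeriv_fderiv_sub (k : ℕ) (F : E → G) (x y : E) :
    ‖iteratedFDeriv ℝ k (fderiv ℝ F) x - iteratedFDeriv ℝ k (fderiv ℝ F) y‖ =
      ‖iteratedFDeriv ℝ (k + 1) F x - iteratedFDeriv ℝ (k + 1) F y‖ := by
  rw [iteratedFDeriv_succ_eq_comp_right, iteratedFDeriv_succ_eq_comp_right]
  simp only [Function.comp_apply]
  rw [← dist_eq_norm, ← dist_eq_norm]
  exact ((continuousMultilinearCurryRightEquiv' ℝ k E G).symm.dist_map _ _).symm

/-- A function vanishing at `w` whose derivative is at most `L / p! * ‖x - w‖ ^ p` is at most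
`L / (p + 1)! * ‖x - w‖ ^ (p + 1)`. -/
theorem norm_le_of_norm_fderiv_le_pow {R : E → G} {R' : E → E →L[ℝ] G} {w : E} {L : ℝ} {p : ℕ}
    (hR : ∀ x, HasFDerivAt R (R' x) x) (hw : R w = 0)
    (hb : ∀ x, ‖R' x‖ ≤ L / (p.factorial : ℝ) * ‖x - w‖ ^ p) (x : E) :
    ‖R x‖ ≤ L / ((p + 1).factorial : ℝ) * ‖x - w‖ ^ (p + 1) := by
  set u := x - w with hu
  have hd : ∀ t : ℝ, HasDerivAt (fun t : ℝ => R (w + t • u)) (R' (w + t • u) u) t := fun t => by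
    have h1 : HasDerivAt (fun t : ℝ => w + t • u) u t := by
      simpa using ((hasDerivAt_id t).smul_const u).const_add w
    exact (hR _).comp_hasDerivAt t h1
  have hB : ∀ t : ℝ, HasDerivAt
      (fun t : ℝ => L / ((p + 1).factorial : ℝ) * ‖u‖ ^ (p + 1) * t ^ (p + 1))
      (L / (p.factorial : ℝ) * ‖u‖ ^ (p + 1) * t ^ p) t := fun t => by
    refine ((hasDerivAt_pow (p + 1) t).const_mul _).congr_deriv ?_
    rw [Nat.factorial_succ]
    have : (p.factorial : ℝ) ≠ 0 := by positivity
    push_cast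
    field_simp
  -- Along the segment `w + t • u`, the growth of `‖R‖` is compared with the explicit primitive in
  -- `hB`.
  have := image_norm_le_of_norm_deriv_right_le_deriv_boundary (a := 0) (b := 1)
    (fun t _ => (hd t).continuousAt.continuousWithinAt)
    (fun t _ => (hd t).hasDerivWithinAt) (by simp [hw]) hB (fun t ht => ?_)
    (Set.right_mem_Icc.2 zero_le_one)
  · simpa [hu] using this
  · refine (ContinuousLinearMap.le_opNorm _ _).trans ?_
    refine (mul_le_mul_of_nonneg_right (hb _) (norm_nonneg _)).trans (le_of_eq ?_)
    rw [add_sub_cancel_left, norm_smul, Real.norm_of_nonneg ht.1]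
    ring

/-- Taylor's theorem with the remainder controlled by the variation of the highest derivative. -/
theorem norm_sub_vectorTaylor_le (p : ℕ) :
    ∀ {G : Type} [NormedAddCommGroup G] [NormedSpace ℝ G] {F : E → G}, ContDiff ℝ p F →
      ∀ {w : E} {L : ℝ},
      (∀ x, ‖iteratedFDeriv ℝ p F x - iteratedFDeriv ℝ p F w‖ ≤ L * ‖x - w‖) →
      ∀ x, ‖F x - vectorTaylor p F w x‖ ≤ L / ((p + 1).factorial : ℝ) * ‖x - w‖ ^ (p + 1) := by
  induction p with
  | zero =>
    intro G _ _ F _ w L h x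
    have := h x
    rw [iteratedFDeriv_zero_eq_comp] at this
    simp only [Function.comp_apply] at this
    rw [← map_sub, LinearIsometryEquiv.norm_map] at this
    simpa [vectorTaylor] using this
  | succ p ih =>
    intro G _ _ F hF w L h x
    have hF' : ContDiff ℝ p (fderiv ℝ F) := hF.fderiv_right (by norm_cast)
    have hdiff : Differentiable ℝ F := hF.differentiable (by norm_cast)
    -- The derivative of the remainder of `F` is the remainder of `fderiv ℝ F` one order lower,
    -- whose codomain differs; hence the induction over all `G`.
    refine norm_le_of_norm_fderiv_le_pow
      (fun y => (hdiff y).hasFDerivAt.sub (hasFDerivAt_vectorTaylor hF w y))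
      (by simp [vectorTaylor_self]) (ih hF' fun y => ?_) x
    rw [norm_iteratedFDeriv_fderiv_sub]
    exact h y

end Taylor


/-! ### Gradient growth, coercivity and Lipschitz bounds. -/

section Optimization

variable {d : ℕ}

theorem IsArgmin.fderiv_eq_zero {φ : Param d → ℝ} {x : Param d} (h : IsArgmin φ x) :
    fderiv ℝ φ x = 0 :=
  IsLocalMin.fderiv_eq_zero (Filter.Eventually.of_forall h)

/-- `φ - ⟪u, ·⟫` is minimized at `x`, so its derivative vanishes there. -/
theorem inner_eq_fderiv_of_mem_subdifferential {φ : Param d → ℝ} {x u : Param d}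
    (hφ : DifferentiableAt ℝ φ x) (hu : u ∈ subdifferential φ x) (v : Param d) :
    ⟪u, v⟫_ℝ = fderiv ℝ φ x v := by
  have hmin : IsLocalMin (fun y => φ y - innerSL ℝ u y) x :=
    Filter.Eventually.of_forall fun y => by
      have := hu y
      rw [inner_sub_right] at this
      simp only [innerSL_apply_apply]
      linarith
  have h := hmin.hasFDerivAt_eq_zero (hφ.hasFDerivAt.sub (innerSL ℝ u).hasFDerivAt)
  have := congrArg (fun A => A v) h
  simp only [sub_apply, innerSL_apply_apply, zero_apply] at this
  linarith

theorem HasGradientGrowth.le_fderiv_sub {ν : ℝ → ℝ} {φ : Param d → ℝ}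
    (h : HasGradientGrowth ν φ) (hφ : Differentiable ℝ φ) (x y : Param d) :
    ν ‖x - y‖ ≤ fderiv ℝ φ y (y - x) - fderiv ℝ φ x (y - x) := by
  obtain ⟨u, hu⟩ := h.1 y
  obtain ⟨v, hv⟩ := h.1 x
  have := h.2 x y u hu v hv
  rwa [real_inner_comm, inner_sub_left, inner_eq_fderiv_of_mem_subdifferential (hφ y) hu,
    inner_eq_fderiv_of_mem_subdifferential (hφ x) hv] at this

/-- Quadratic gradient growth forces at least quadratic growth of the function. -/
theorem HasGradientGrowth.quadratic_le {c : ℝ} {φ : Param d → ℝ}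
    (h : HasGradientGrowth (fun r => c * r ^ 2) φ) :
    ∃ b : ℝ, ∀ y, φ 0 - b * ‖y‖ + c / 4 * ‖y‖ ^ 2 ≤ φ y := by
  obtain ⟨u, hu⟩ := h.1 0
  refine ⟨‖u‖, fun y => ?_⟩
  -- Subgradient inequalities from `0` to the midpoint `q` and from `q` to `y`, plus growth between
  -- `0` and `q`, add up to the claim; `c / 4` is `c * ‖q‖ ^ 2` in terms of `‖y‖`.
  set q : Param d := (1 / 2 : ℝ) • y with hq
  obtain ⟨v, hv⟩ := h.1 q
  have h1 := hu q
  have h2 := hv y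
  have h3 := h.2 0 q v hv u hu
  have hyq : y - q = q := by rw [hq]; module
  rw [hyq] at h2
  rw [sub_zero] at h1 h3
  rw [zero_sub, norm_neg, real_inner_comm, inner_sub_left] at h3
  have hn : ‖q‖ = 1 / 2 * ‖y‖ := by rw [hq, norm_smul]; norm_num
  have h4 := abs_le.1 (abs_real_inner_le_norm u q)
  rw [hn] at h3 h4
  nlinarith [h4.1]

theorem tendsto_atTop_of_quadratic_le {a b c : ℝ} (hc : 0 < c) {φ : Param d → ℝ}
    (h : ∀ y, a - b * ‖y‖ + c / 4 * ‖y‖ ^ 2 ≤ φ y) :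
    Filter.Tendsto φ (Filter.cocompact (Param d)) Filter.atTop := by
  have h1 : Filter.Tendsto (fun t : ℝ => a + t * (c / 4 * t - b)) Filter.atTop Filter.atTop := by
    refine Filter.tendsto_atTop_add_const_left _ _ (Filter.tendsto_id.atTop_mul_atTop₀ ?_)
    exact Filter.tendsto_atTop_add_const_right _ _
      (Filter.tendsto_id.const_mul_atTop (by positivity))
  refine Filter.tendsto_atTop_mono (fun y => ?_)
    (h1.comp (tendsto_norm_cocompact_atTop (E := Param d)))
  have := h y
  simp only [Function.comp_apply]
  nlinarith

theorem edist_le_lipConst_mul {X Y : Type*} [PseudoEMetricSpace X] [PseudoEMetricSpace Y]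
    {f : X → Y} {x y : X} (h0 : edist x y ≠ 0) (htop : edist x y ≠ ∞) :
    edist (f x) (f y) ≤ lipConst f * edist x y := by
  have hne : x ≠ y := fun h => h0 (h ▸ edist_self x)
  refine (ENNReal.div_le_iff h0 htop).1 ?_
  exact le_iSup_of_le x (le_iSup_of_le y (le_iSup_of_le hne le_rfl))

theorem norm_sub_le_lipConst_mul {X Y : Type*} [NormedAddCommGroup X] [NormedAddCommGroup Y]
    {f : X → Y} (hf : lipConst f ≠ ∞) (x y : X) :
    ‖f x - f y‖ ≤ (lipConst f).toReal * ‖x - y‖ := by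
  rcases eq_or_ne x y with rfl | hne
  · simp
  have h := edist_le_lipConst_mul (f := f) (edist_pos.2 hne).ne' (edist_ne_top x y)
  rw [← dist_eq_norm, ← dist_eq_norm, dist_edist, dist_edist, ← ENNReal.toReal_mul]
  exact ENNReal.toReal_mono (ENNReal.mul_ne_top hf (edist_ne_top x y)) h

theorem taylorPoly_eq_vectorTaylor (p : ℕ) (f : Param d → ℝ) :
    taylorPoly p f = vectorTaylor p f := by
  ext w β
  simp [taylorPoly, vectorTaylor]

/-! ### Minimizers of the regularized Taylor approximation. -/

section Smooth

variable {p : ℕ} {f : Param d → ℝ}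

/-- The regularizer is exactly the Taylor remainder bound. As a majorant of a coercive function,
`regTaylor` is coercive and so has a minimizer. -/
theorem le_regTaylor (hf : ContDiff ℝ p f) (hL : lipConst (iteratedFDeriv ℝ p f) ≠ ∞)
    (w β : Param d) : f β ≤ regTaylor p f w β := by
  have h := norm_sub_vectorTaylor_le p hf
    (fun x => norm_sub_le_lipConst_mul hL x w) β
  rw [Real.norm_eq_abs] at h
  have := (abs_le.1 h).2
  rw [regTaylor, taylorPoly_eq_vectorTaylor]
  linarith

/-- The derivative of the regularized Taylor approximation. -/
def regTaylorDeriv (p : ℕ) (f : Param d → ℝ) (w β : Param d) : Param d →L[ℝ] ℝ :=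
  vectorTaylor p (fderiv ℝ f) w β +
    ((lipConst (iteratedFDeriv ℝ (p + 1) f)).toReal / ((p + 1).factorial : ℝ) *
      ‖β - w‖ ^ p) • innerSL ℝ (β - w)

theorem hasFDerivAt_norm_sub_pow (p : ℕ) (w β : Param d) :
    HasFDerivAt (fun x : Param d => ‖x - w‖ ^ (p + 2))
      ((((p : ℝ) + 2) * ‖β - w‖ ^ p) • innerSL ℝ (β - w)) β := by
  have h := (hasFDerivAt_norm_rpow (β - w) (p := ((p + 2 : ℕ) : ℝ))
    (by push_cast; linarith [(Nat.cast_nonneg p : (0 : ℝ) ≤ p)])).comp β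
    ((hasFDerivAt_id β).sub_const w)
  have h2 : ((p + 2 : ℕ) : ℝ) - 2 = p := by push_cast; ring
  rw [h2] at h
  simp only [Real.rpow_natCast] at h
  refine h.congr_fderiv ?_
  ext v
  simp

theorem hasFDerivAt_regTaylor (hf : ContDiff ℝ (p + 1 : ℕ) f) (w β : Param d) :
    HasFDerivAt (regTaylor (p + 1) f w) (regTaylorDeriv p f w β) β := by
  have h := (hasFDerivAt_vectorTaylor hf w β).add ((hasFDerivAt_norm_sub_pow p w β).const_mul
    ((lipConst (iteratedFDeriv ℝ (p + 1) f)).toReal / ((p + 2).factorial : ℝ)))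
  rw [← taylorPoly_eq_vectorTaylor] at h
  refine h.congr_fderiv ?_
  rw [regTaylorDeriv, smul_smul]
  congr 2
  rw [Nat.factorial_succ (p + 1)]
  have : ((p + 1).factorial : ℝ) ≠ 0 := by positivity
  push_cast
  field_simp
  ring

theorem exists_isArgmin_of_growth {c : ℝ} (hc : 0 < c)
    (hg : HasGradientGrowth (fun r => c * r ^ 2) f) {g : Param d → ℝ} (hcont : Continuous g)
    (hle : ∀ x, f x ≤ g x) : ∃ β, IsArgmin g β := by
  obtain ⟨b, hb⟩ := hg.quadratic_le
  exact hcont.exists_forall_le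
    (tendsto_atTop_of_quadratic_le hc fun y => (hb y).trans (hle y))

theorem mul_le_of_mul_sq_le_mul {c r a : ℝ} (hr : 0 ≤ r) (ha : 0 ≤ a)
    (h : c * r ^ 2 ≤ a * r) : c * r ≤ a := by
  rcases hr.eq_or_lt with rfl | hr
  · simpa using ha
  · exact le_of_mul_le_mul_right (by linarith [h, sq r]) hr

/-- Strong monotonicity between `w` and `x`. Asking only for a radial sign at `x` lets it apply to
both kinds of minimizer. -/
theorem HasGradientGrowth.mul_norm_sub_le {c : ℝ} (hf : Differentiable ℝ f)
    (hg : HasGradientGrowth (fun r => c * r ^ 2) f) {x : Param d}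
    (w : Param d) (hx : fderiv ℝ f x (x - w) ≤ 0) : c * ‖x - w‖ ≤ ‖fderiv ℝ f w‖ := by
  refine mul_le_of_mul_sq_le_mul (norm_nonneg _) (norm_nonneg _) ?_
  have h := hg.le_fderiv_sub hf w x
  rw [norm_sub_rev] at h
  have h2 := (abs_le.1 ((fderiv ℝ f w).le_opNorm (x - w))).1
  linarith

theorem norm_fderiv_sub_vectorTaylor_le (hf : ContDiff ℝ (p + 1 : ℕ) f)
    (hL : lipConst (iteratedFDeriv ℝ (p + 1) f) ≠ ∞) (w β : Param d) :
    ‖fderiv ℝ f β - vectorTaylor p (fderiv ℝ f) w β‖ ≤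
      (lipConst (iteratedFDeriv ℝ (p + 1) f)).toReal / ((p + 1).factorial : ℝ) *
        ‖β - w‖ ^ (p + 1) :=
  norm_sub_vectorTaylor_le p (hf.fderiv_right (by norm_cast)) (fun x => by
    rw [norm_iteratedFDeriv_fderiv_sub]
    exact norm_sub_le_lipConst_mul hL x w) β

/-- At a minimizer of the regularized Taylor approximation the original function does not
increase in the radial direction. -/
theorem IsArgmin.fderiv_radial_nonpos (hf : ContDiff ℝ (p + 1 : ℕ) f)
    (hL : lipConst (iteratedFDeriv ℝ (p + 1) f) ≠ ∞) {w x : Param d}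
    (hx : IsArgmin (regTaylor (p + 1) f w) x) : fderiv ℝ f x (x - w) ≤ 0 := by
  have h0 := congrArg (fun A => A (x - w))
    ((hasFDerivAt_regTaylor hf w x).fderiv.symm.trans hx.fderiv_eq_zero)
  simp only [regTaylorDeriv, add_apply, smul_apply, innerSL_apply_apply,
    real_inner_self_eq_norm_sq, zero_apply, smul_eq_mul] at h0
  -- The Taylor remainder of `f'`, tested on `x - w`, is at most the regularizer's contribution in
  -- `h0`, so the two cancel.
  have h1 := (abs_le.1 ((fderiv ℝ f x - vectorTaylor p (fderiv ℝ f) w x).le_of_opNorm_le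
    (norm_fderiv_sub_vectorTaylor_le hf hL w x) (x - w))).2
  rw [sub_apply] at h1
  have h2 : ∀ a : ℝ, a * ‖x - w‖ ^ (p + 1) * ‖x - w‖ = a * ‖x - w‖ ^ p * ‖x - w‖ ^ 2 :=
    fun a => by ring
  rw [h2] at h1
  linarith

/-- By stationarity `f'(x)` is the Taylor remainder minus the regularizer's gradient; each obeys the
same bound, whence the factor 2. -/
theorem norm_fderiv_le_of_isArgmin_regTaylor (hf : ContDiff ℝ (p + 1 : ℕ) f)
    (hL : lipConst (iteratedFDeriv ℝ (p + 1) f) ≠ ∞) {w x : Param d}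
    (hx : IsArgmin (regTaylor (p + 1) f w) x) :
    ‖fderiv ℝ f x‖ ≤ 2 * ((lipConst (iteratedFDeriv ℝ (p + 1) f)).toReal /
      ((p + 1).factorial : ℝ) * ‖x - w‖ ^ (p + 1)) := by
  have h0 := (hasFDerivAt_regTaylor hf w x).fderiv.symm.trans hx.fderiv_eq_zero
  rw [regTaylorDeriv] at h0
  set a := (lipConst (iteratedFDeriv ℝ (p + 1) f)).toReal / ((p + 1).factorial : ℝ) with ha
  have ha0 : 0 ≤ a := by positivity
  have h1 : fderiv ℝ f x = (fderiv ℝ f x - vectorTaylor p (fderiv ℝ f) w x) -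
      (a * ‖x - w‖ ^ p) • innerSL ℝ (x - w) := by
    rw [sub_sub, h0, sub_zero]
  rw [h1]
  refine (norm_sub_le _ _).trans ?_
  rw [two_mul]
  refine add_le_add (norm_fderiv_sub_vectorTaylor_le hf hL w x) (le_of_eq ?_)
  rw [norm_smul, innerSL_apply_norm, Real.norm_of_nonneg (by positivity)]
  ring

theorem IsArgmin.mul_norm_sub_regTaylor_le {c : ℝ} (hf : ContDiff ℝ (p + 1 : ℕ) f)
    (hL : lipConst (iteratedFDeriv ℝ (p + 1) f) ≠ ∞)
    (hg : HasGradientGrowth (fun r => c * r ^ 2) f) {w x y : Param d} (hy : IsArgmin f y)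
    (hx : IsArgmin (regTaylor (p + 1) f w) x) :
    c * ‖x - y‖ ≤ 2 * ((lipConst (iteratedFDeriv ℝ (p + 1) f)).toReal /
      ((p + 1).factorial : ℝ) * ‖x - w‖ ^ (p + 1)) := by
  refine le_trans ?_ (norm_fderiv_le_of_isArgmin_regTaylor hf hL hx)
  refine mul_le_of_mul_sq_le_mul (norm_nonneg _) (norm_nonneg _) ?_
  have h := hg.le_fderiv_sub (hf.differentiable (by norm_cast)) y x
  rw [norm_sub_rev, hy.fderiv_eq_zero, zero_apply, sub_zero] at h
  exact h.trans ((le_abs_self _).trans ((fderiv ℝ f x).le_opNorm _))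

end Smooth

/-- The increment of a function with Lipschitz gradient between two points of a ball about `w`. -/
theorem abs_sub_le_of_mem_closedBall {g : Param d → ℝ} (hg : Differentiable ℝ g)
    (hL : lipConst (gradient g) ≠ ∞) {w x y : Param d} {r : ℝ}
    (hx : ‖x - w‖ ≤ r) (hy : ‖y - w‖ ≤ r) :
    |g x - g y| ≤ (‖gradient g w‖ + (lipConst (gradient g)).toReal * r) * ‖x - y‖ := by
  have hn : ∀ u, ‖fderiv ℝ g u‖ = ‖gradient g u‖ := fun u => by
    rw [gradient, LinearIsometryEquiv.norm_map]
  refine Convex.norm_image_sub_le_of_norm_fderiv_le (𝕜 := ℝ) (s := Metric.closedBall w r)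
    (fun u _ => hg u) (fun u hu => ?_) (convex_closedBall w r)
    (by rwa [mem_closedBall_iff_norm]) (by rwa [mem_closedBall_iff_norm])
  rw [hn]
  rw [mem_closedBall_iff_norm] at hu
  have h1 := norm_sub_le_lipConst_mul hL u w
  have h2 := norm_le_norm_add_norm_sub' (gradient g u) (gradient g w)
  have h3 : (lipConst (gradient g)).toReal * ‖u - w‖ ≤ (lipConst (gradient g)).toReal * r :=
    mul_le_mul_of_nonneg_left hu ENNReal.toReal_nonneg
  linarith

end Optimization


/-- Above `lamr` this is a mediant inequality; below it the denominator is constant and the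
numerator increases. -/
theorem kappa_le_max (p : ℕ) (cl cr lamr Cl Cr : ℝ≥0) (hcl : 0 < cl) (hcr : 0 < cr) :
    kappa p cl cr lamr Cl Cr ≤
      max (((Cl : ℝ≥0∞) + lamr * Cr) / ((p.factorial : ℝ≥0∞) * cl))
        ((Cr : ℝ≥0∞) / ((p.factorial : ℝ≥0∞) * cr)) := by
  have hp : (p.factorial : ℝ≥0∞) ≠ 0 := by exact_mod_cast p.factorial_ne_zero
  have hp' : (p.factorial : ℝ≥0∞) ≠ ∞ := ENNReal.natCast_ne_top _
  have hcl' : (cl : ℝ≥0∞) ≠ 0 := by exact_mod_cast hcl.ne'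
  have hcr' : (cr : ℝ≥0∞) ≠ 0 := by exact_mod_cast hcr.ne'
  refine iSup_le fun lam => ?_
  by_cases h : lamr ≤ lam
  · set M := max (((Cl : ℝ≥0∞) + lamr * Cr) / ((p.factorial : ℝ≥0∞) * cl))
      ((Cr : ℝ≥0∞) / ((p.factorial : ℝ≥0∞) * cr)) with hM
    have h1 : (Cl : ℝ≥0∞) ≤ M * (p.factorial * cl) := by
      refine (ENNReal.div_le_iff (mul_ne_zero hp hcl')
        (ENNReal.mul_ne_top hp' ENNReal.coe_ne_top)).1 (le_trans ?_ (le_max_left _ _))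
      gcongr
      exact le_self_add
    have h2 : (Cr : ℝ≥0∞) ≤ M * (p.factorial * cr) :=
      (ENNReal.div_le_iff (mul_ne_zero hp hcr')
        (ENNReal.mul_ne_top hp' ENNReal.coe_ne_top)).1 (le_max_right _ _)
    refine ENNReal.div_le_of_le_mul ?_
    rw [curvature, if_pos (by exact_mod_cast h)]
    calc (Cl : ℝ≥0∞) + lam * Cr
        ≤ M * (p.factorial * cl) + lam * (M * (p.factorial * cr)) := by gcongr
      _ = M * (p.factorial * (cl + lam * cr)) := by ring
  · refine le_trans ?_ (le_max_left _ _)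
    rw [curvature, if_neg (by exact_mod_cast h), mul_zero, add_zero]
    have : (lam : ℝ≥0∞) ≤ lamr := by exact_mod_cast (not_le.1 h).le
    gcongr

/-! ### Fold-wise error and averaging. -/

section Estimators

variable {𝒳 : Type*} {d n p : ℕ}

theorem fullObjective_eq_add (loss : 𝒳 → Param d → ℝ) (reg : Param d → ℝ) (z : Fin n → 𝒳)
    (i : Fin n) {lam : ℝ≥0∞} (hlam : lam ≠ ∞) (β : Param d) :
    fullObjective loss reg z lam β =
      looObjective loss reg z i lam β + (1 / (n : ℝ)) * loss (z i) β := by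
  rw [fullObjective, looObjective, if_neg hlam, if_neg hlam,
    ← Finset.sum_erase_add _ _ (Finset.mem_univ i)]
  ring

/-- At `w` the full gradient vanishes, so the leave-one-out gradient is minus the omitted term. -/
theorem norm_fderiv_looObjective {loss : 𝒳 → Param d → ℝ} {reg : Param d → ℝ} {z : Fin n → 𝒳}
    {i : Fin n} {lam : ℝ≥0∞} (hlam : lam ≠ ∞) {w : Param d}
    (hw : IsArgmin (fullObjective loss reg z lam) w)
    (hm : DifferentiableAt ℝ (looObjective loss reg z i lam) w)
    (hl : DifferentiableAt ℝ (loss (z i)) w) :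
    ‖fderiv ℝ (looObjective loss reg z i lam) w‖ = ‖gradient (loss (z i)) w‖ / n := by
  have h0 := hw.fderiv_eq_zero
  rw [funext (fullObjective_eq_add loss reg z i hlam),
    fderiv_fun_add hm (hl.const_mul _), fderiv_const_mul hl] at h0
  rw [eq_neg_of_add_eq_zero_left h0, norm_neg, norm_smul, gradient, LinearIsometryEquiv.norm_map,
    Real.norm_of_nonneg (by positivity)]
  ring

/-- The difference of the losses of the exact and the approximate leave-one-out estimators. -/
theorem ofReal_abs_loss_sub_le {m g : Param d → ℝ} {w x y : Param d} {c : ℝ≥0}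
    {K : ℝ≥0∞} (hn : 0 < n) (hc : 0 < c)
    (hm : ContDiff ℝ (p + 1 : ℕ) m) (hg : Differentiable ℝ g)
    (hL : lipConst (iteratedFDeriv ℝ (p + 1) m) ≠ ∞)
    (hK : lipConst (iteratedFDeriv ℝ (p + 1) m) / (((p + 1).factorial : ℝ≥0∞) * c) ≤ K)
    (hgrow : HasGradientGrowth (fun r => c * r ^ 2) m)
    (hw : ‖fderiv ℝ m w‖ = ‖gradient g w‖ / n)
    (hy : IsArgmin m y) (hx : IsArgmin (regTaylor (p + 1) m w) x)
    (hmom : lipConst (gradient g) * ‖gradient g w‖ₑ ^ (p + 2) ≠ ∞) :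
    ENNReal.ofReal |g x - g y| ≤ 2 * K / (n : ℝ≥0∞) ^ (p + 1) *
      (‖gradient g w‖ₑ ^ (p + 2) / (c : ℝ≥0∞) ^ (p + 1) +
        lipConst (gradient g) * ‖gradient g w‖ₑ ^ (p + 2) / (n * (c : ℝ≥0∞) ^ (p + 2))) := by
  have hc' : (0 : ℝ) < c := hc
  have hn' : (0 : ℝ) < n := by exact_mod_cast hn
  set γ := ‖gradient g w‖ with hγ
  set ρ := γ / n / c with hρ
  have hγ0 : 0 ≤ γ := norm_nonneg _
  have hdm : Differentiable ℝ m := hm.differentiable (by norm_cast)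
  have hyw : ‖y - w‖ ≤ ρ := by
    rw [hρ, ← hw, le_div_iff₀' hc']
    exact hgrow.mul_norm_sub_le hdm w (by simp [hy.fderiv_eq_zero])
  have hxw : ‖x - w‖ ≤ ρ := by
    rw [hρ, ← hw, le_div_iff₀' hc']
    exact hgrow.mul_norm_sub_le hdm w (hx.fderiv_radial_nonpos hm hL)
  set L := (lipConst (iteratedFDeriv ℝ (p + 1) m)).toReal with hLdef
  have hL0 : 0 ≤ L := ENNReal.toReal_nonneg
  set k := L / ((p + 1).factorial * c) with hk
  have hk0 : 0 ≤ k := by positivity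
  have hxy : ‖x - y‖ ≤ 2 * k * ρ ^ (p + 1) := by
    have h1 := hy.mul_norm_sub_regTaylor_le hm hL hgrow hx
    rw [← le_div_iff₀' hc'] at h1
    refine h1.trans ?_
    have h2 : ‖x - w‖ ^ (p + 1) ≤ ρ ^ (p + 1) := pow_le_pow_left₀ (norm_nonneg _) hxw _
    calc _ = 2 * k * ‖x - w‖ ^ (p + 1) := by rw [hk, ← hLdef]; field_simp
      _ ≤ _ := by gcongr
  -- If the loss gradient is not Lipschitz, finiteness of the moment forces `γ = 0`, so `ρ = 0` and
  -- `x = y`.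
  rcases eq_or_ne (lipConst (gradient g)) ∞ with htop | htop
  · have hγ00 : γ = 0 := by
      by_contra h
      refine hmom ?_
      rw [htop, ENNReal.top_mul]
      exact pow_ne_zero _ (by rwa [enorm_ne_zero, ← norm_ne_zero_iff])
    have h1 : x = y := by
      rw [hρ, hγ00] at hxy
      simpa [sub_eq_zero] using hxy
    simp [h1]
  set l := (lipConst (gradient g)).toReal with hl
  have hl0 : 0 ≤ l := ENNReal.toReal_nonneg
  have hreal : |g x - g y| ≤
      2 * k / n ^ (p + 1) * (γ ^ (p + 2) / c ^ (p + 1) + l * γ ^ (p + 2) / (n * c ^ (p + 2))) := by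
    refine (abs_sub_le_of_mem_closedBall hg htop hxw hyw).trans ?_
    calc (γ + l * ρ) * ‖x - y‖ ≤ (γ + l * ρ) * (2 * k * ρ ^ (p + 1)) := by gcongr
      _ = _ := by
        rw [hρ, div_div, div_pow, mul_pow, pow_succ γ (p + 1), pow_succ (c : ℝ) (p + 1)]
        field_simp
  have hkK : ENNReal.ofReal k ≤ K := by
    rw [hk, ENNReal.ofReal_div_of_pos (by positivity), hLdef, ENNReal.ofReal_toReal hL,
      ENNReal.ofReal_mul (by positivity), ENNReal.ofReal_natCast, ENNReal.ofReal_coe_nnreal]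
    exact hK
  clear_value k
  refine (ENNReal.ofReal_le_ofReal hreal).trans ?_
  rw [ENNReal.ofReal_mul (by positivity), ENNReal.ofReal_div_of_pos (by positivity),
    ENNReal.ofReal_mul (by positivity), ENNReal.ofReal_add (by positivity) (by positivity),
    ENNReal.ofReal_div_of_pos (by positivity), ENNReal.ofReal_div_of_pos (by positivity),
    ENNReal.ofReal_mul hl0, ENNReal.ofReal_mul (by positivity),
    ENNReal.ofReal_pow hγ0, ENNReal.ofReal_pow (by positivity), ENNReal.ofReal_pow (by positivity),
    ENNReal.ofReal_pow (by positivity), ENNReal.ofReal_natCast, ENNReal.ofReal_coe_nnreal,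
    hl, ENNReal.ofReal_toReal htop, hγ, ofReal_norm, ENNReal.ofReal_ofNat]
  gcongr

/-- Averaging fold-wise loss differences. -/
theorem ofReal_abs_foldError_sub_le (loss : 𝒳 → Param d → ℝ) (z : Fin n → 𝒳)
    (a b : Fin n → Param d) :
    ENNReal.ofReal |foldError loss z a - foldError loss z b| ≤
      1 / (n : ℝ≥0∞) * ∑ i, ENNReal.ofReal |loss (z i) (a i) - loss (z i) (b i)| := by
  rcases Nat.eq_zero_or_pos n with rfl | hn
  · simp [foldError]
  have hn' : (0 : ℝ) < n := by exact_mod_cast hn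
  rw [foldError, foldError, ← mul_sub, ← Finset.sum_sub_distrib, abs_mul,
    abs_of_nonneg (by positivity), ENNReal.ofReal_mul (by positivity),
    ENNReal.ofReal_div_of_pos hn', ENNReal.ofReal_one, ENNReal.ofReal_natCast,
    ← ENNReal.ofReal_sum_of_nonneg fun _ _ => abs_nonneg _]
  gcongr
  exact Finset.abs_sum_le_sum_abs _ _

theorem average_le_lossMoment (loss : 𝒳 → Param d → ℝ) (z : Fin n → 𝒳) {Lam : Set ℝ≥0∞}
    (est : ℝ≥0∞ → Param d) (s r : ℕ) {lam : ℝ≥0∞} (hlam : lam ∈ Lam) :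
    1 / (n : ℝ≥0∞) *
      ∑ i, lipConst (gradient (loss (z i))) ^ s * ‖gradient (loss (z i)) (est lam)‖ₑ ^ r ≤
        lossMoment loss z Lam est s r :=
  le_iSup₂_of_le lam hlam le_rfl

theorem lossMoment_summand_ne_top {loss : 𝒳 → Param d → ℝ} {z : Fin n → 𝒳} {Lam : Set ℝ≥0∞}
    {est : ℝ≥0∞ → Param d} {s r : ℕ} (h : lossMoment loss z Lam est s r < ∞) {lam : ℝ≥0∞}
    (hlam : lam ∈ Lam) (i : Fin n) :
    lipConst (gradient (loss (z i))) ^ s * ‖gradient (loss (z i)) (est lam)‖ₑ ^ r ≠ ∞ := by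
  have h1 := ((average_le_lossMoment loss z est s r hlam).trans_lt h).ne
  intro htop
  refine h1 ?_
  rw [ENNReal.sum_eq_top.2 ⟨i, Finset.mem_univ i, htop⟩, ENNReal.mul_top]
  simp

end Estimators

end ApproxCV

end

/-! ### Assembly of existence, the constant and the error bound. -/

theorem mainTheorem2 {𝒳 : Type*} {d n p : ℕ} (hn : 0 < n) (hp : 1 ≤ p)
    (loss : 𝒳 → ApproxCV.Param d → ℝ) (reg : ApproxCV.Param d → ℝ) (z : Fin n → 𝒳)
    (hdiff : ∀ i, Differentiable ℝ (loss (z i)))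
    (Lam : Set ℝ≥0∞)
    -- the full-data estimators
    (est : ℝ≥0∞ → ApproxCV.Param d)
    (hest : ∀ lam ∈ Lam, ApproxCV.IsArgmin (ApproxCV.fullObjective loss reg z lam) (est lam))
    (cl cr lamr Cl Cr : ℝ≥0) (hcl : 0 < cl) (hcr : 0 < cr)
    (hcurv : ApproxCV.CurvedObjective loss reg z Lam cl cr lamr)
    (hlip : ApproxCV.LipschitzDerivObjective p loss reg z Lam Cl Cr)
    (hB0 : ApproxCV.lossMoment loss z Lam est 0 (p + 1) < ∞)
    (hB1 : ApproxCV.lossMoment loss z Lam est 1 (p + 1) < ∞)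
    (hB2 : ApproxCV.lossMoment loss z Lam est 1 (2 * p) < ∞) :
    -- the leave-one-out estimators and their approximations exist
    (∀ lam ∈ Lam, ∀ i : Fin n,
      (∃ β, ApproxCV.IsArgmin (ApproxCV.looObjective loss reg z i lam) β) ∧
      (∃ β, ApproxCV.IsArgmin
        (ApproxCV.regTaylor p (ApproxCV.looObjective loss reg z i lam) (est lam)) β)) ∧
    ApproxCV.kappa p cl cr lamr Cl Cr ≤
      max (((Cl : ℝ≥0∞) + lamr * Cr) / ((p.factorial : ℝ≥0∞) * cl))
        ((Cr : ℝ≥0∞) / ((p.factorial : ℝ≥0∞) * cr)) ∧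
    -- the assessment error bound, for every choice of minimizers
    ∀ lam ∈ Lam, ∀ cv acv : Fin n → ApproxCV.Param d,
      (∀ i, ApproxCV.IsArgmin (ApproxCV.looObjective loss reg z i lam) (cv i)) →
      (∀ i, ApproxCV.IsArgmin
        (ApproxCV.regTaylor p (ApproxCV.looObjective loss reg z i lam) (est lam)) (acv i)) →
      ENNReal.ofReal |ApproxCV.foldError loss z acv - ApproxCV.foldError loss z cv| ≤
        2 * ApproxCV.kappa p cl cr lamr Cl Cr / (n : ℝ≥0∞) ^ p *
          (ApproxCV.lossMoment loss z Lam est 0 (p + 1) /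
              ApproxCV.curvature cl cr lamr lam ^ p +
            ApproxCV.lossMoment loss z Lam est 1 (p + 1) /
              ((n : ℝ≥0∞) * ApproxCV.curvature cl cr lamr lam ^ (p + 1)) +
            ApproxCV.kappa p cl cr lamr Cl Cr * ApproxCV.lossMoment loss z Lam est 1 (2 * p) /
              ((n : ℝ≥0∞) ^ p * ApproxCV.curvature cl cr lamr lam ^ (2 * p))) := by
  open ApproxCV in
  obtain ⟨q, rfl⟩ : ∃ q, p = q + 1 := ⟨p - 1, by omega⟩
  have hL : ∀ lam ∈ Lam, ∀ i, lipConst (iteratedFDeriv ℝ (q + 1)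
      (looObjective loss reg z i lam)) ≠ ∞ := fun lam hlam i => by
    refine ne_top_of_le_ne_top ?_ (hlip lam hlam i).2
    split_ifs with h
    · exact ENNReal.coe_ne_top
    · finiteness
  refine ⟨fun lam hlam i => ?_, kappa_le_max _ cl cr lamr Cl Cr hcl hcr,
    fun lam hlam cv acv hcv hacv => ?_⟩
  · have hpos : (0 : ℝ) < if lam = ∞ then (cr : ℝ) else (curvature cl cr lamr lam).toReal := by
      split_ifs with h
      · exact hcr
      · refine ENNReal.toReal_pos ?_ ?_
        · rw [curvature]
          have : (cl : ℝ≥0∞) ≠ 0 := by exact_mod_cast hcl.ne'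
          simp [this]
        · rw [curvature]
          split_ifs <;> finiteness
    have hsm := (hlip lam hlam i).1
    exact ⟨exists_isArgmin_of_growth hpos (hcurv lam hlam i) hsm.continuous fun _ => le_rfl,
      exists_isArgmin_of_growth hpos (hcurv lam hlam i)
        (continuous_iff_continuousAt.2 fun β =>
          (hasFDerivAt_regTaylor hsm (est lam) β).continuousAt)
        (le_regTaylor hsm (hL lam hlam i) (est lam))⟩
  rcases eq_or_ne lam ∞ with htop | htop
  -- At `λ = ∞` the full and leave-one-out objectives are both `π`, so `est lam` is stationary and
  -- both estimators collapse onto it.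
  · have heq : acv = cv := by
      funext i
      have hsm := (hlip lam hlam i).1
      have hdm := hsm.differentiable (by norm_cast)
      have hg := hcurv lam hlam i
      rw [if_pos htop] at hg
      have hfull : fullObjective loss reg z lam = looObjective loss reg z i lam := by
        ext β
        rw [fullObjective, looObjective, if_pos htop, if_pos htop]
      have hw := hest lam hlam
      rw [hfull] at hw
      have key : ∀ x, fderiv ℝ (looObjective loss reg z i lam) x (x - est lam) ≤ 0 →
          x = est lam := fun x hx => by
        have h := hg.mul_norm_sub_le hdm (est lam) hx
        rw [hw.fderiv_eq_zero, norm_zero] at h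
        have h2 : ‖x - est lam‖ ≤ 0 := nonpos_of_mul_nonpos_right h (by exact_mod_cast hcr)
        exact sub_eq_zero.1 (norm_le_zero_iff.1 h2)
      rw [key (acv i) ((hacv i).fderiv_radial_nonpos hsm (hL lam hlam i)),
        key (cv i) (by simp [(hcv i).fderiv_eq_zero])]
    simp [heq]
  obtain ⟨c, hc⟩ : ∃ c : ℝ≥0, curvature cl cr lamr lam = c := by
    refine ⟨(curvature cl cr lamr lam).toNNReal, (ENNReal.coe_toNNReal ?_).symm⟩
    rw [curvature]
    split_ifs <;> finiteness
  have hc0 : 0 < c := by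
    have : (cl : ℝ≥0∞) ≤ c := hc ▸ le_self_add
    exact hcl.trans_le (by exact_mod_cast this)
  set K := kappa (q + 1) cl cr lamr Cl Cr with hK
  have hfold : ∀ i, ENNReal.ofReal |loss (z i) (acv i) - loss (z i) (cv i)| ≤
      2 * K / (n : ℝ≥0∞) ^ (q + 1) *
        (‖gradient (loss (z i)) (est lam)‖ₑ ^ (q + 2) / (c : ℝ≥0∞) ^ (q + 1) +
          lipConst (gradient (loss (z i))) * ‖gradient (loss (z i)) (est lam)‖ₑ ^ (q + 2) /
            (n * (c : ℝ≥0∞) ^ (q + 2))) := fun i => by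
    have hsm := (hlip lam hlam i).1
    have hg := hcurv lam hlam i
    rw [if_neg htop, hc, ENNReal.coe_toReal] at hg
    refine ofReal_abs_loss_sub_le hn hc0 hsm (hdiff i) (hL lam hlam i) ?_ hg
      (norm_fderiv_looObjective htop (hest lam hlam) (hsm.differentiable (by norm_cast) _)
        (hdiff i _)) (hcv i) (hacv i) ?_
    · have h1 := (hlip lam hlam i).2
      rw [if_neg htop] at h1
      rw [← hc]
      refine (ENNReal.div_le_div_right h1 _).trans ?_
      refine le_trans (le_of_eq ?_) (le_iSup _ lam.toNNReal)
      rw [ENNReal.coe_toNNReal htop]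
    · simpa using lossMoment_summand_ne_top hB1 hlam i
  rw [hc]
  have h0 := average_le_lossMoment loss z est 0 (q + 1 + 1) hlam
  have h1 := average_le_lossMoment loss z est 1 (q + 1 + 1) hlam
  simp only [pow_zero, one_mul, pow_one] at h0 h1
  refine (ofReal_abs_foldError_sub_le loss z acv cv).trans ?_
  calc _ ≤ 1 / (n : ℝ≥0∞) * ∑ i, 2 * K / (n : ℝ≥0∞) ^ (q + 1) *
        (‖gradient (loss (z i)) (est lam)‖ₑ ^ (q + 2) / (c : ℝ≥0∞) ^ (q + 1) +
          lipConst (gradient (loss (z i))) * ‖gradient (loss (z i)) (est lam)‖ₑ ^ (q + 2) /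
            (n * (c : ℝ≥0∞) ^ (q + 2))) := by
        gcongr with i
        exact hfold i
    _ = 2 * K / (n : ℝ≥0∞) ^ (q + 1) *
        ((1 / (n : ℝ≥0∞) * ∑ i, ‖gradient (loss (z i)) (est lam)‖ₑ ^ (q + 2)) /
            (c : ℝ≥0∞) ^ (q + 1) +
          (1 / (n : ℝ≥0∞) * ∑ i, lipConst (gradient (loss (z i))) *
            ‖gradient (loss (z i)) (est lam)‖ₑ ^ (q + 2)) / (n * (c : ℝ≥0∞) ^ (q + 2))) := by
        rw [← Finset.mul_sum, Finset.sum_add_distrib]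
        simp only [div_eq_mul_inv, ← Finset.sum_mul]
        ring
    _ ≤ _ := by
        refine mul_le_mul_right ?_ _
        -- The first two terms already suffice; the third is nonnegative slack.
        refine le_trans ?_ le_self_add
        gcongr
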